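/- Let $B\subset\mathbb R^d$ be a compact set with non-empty interior and let $\lambda\in(0,\infty)$. Let $\Xi=\sum_{j\in\mathbb Z}\varepsilon_{\xi_j}$ be a homogeneous Poisson process on $\mathbb R^d$ with rate $\lambda$, let $\{Y_t,t\ge 0\}$ be a stochastic process in $\mathbb R^d$, and let $\{Y^{(j)}_t,t\ge 0\}$, $j\in\mathbb Z$, be independent copies of it, such that the family $(Y^{(j)})_{j\in\mathbb Z}$ is independent of the sequence of points $(\xi_j)_{j\in\mathbb Z}$. Define the Smoluchowski process $$N(t)=\sum_{j\in\mathbb Z}\mathbf 1\{\xi_j+Y^{(j)}_t\in B\},\qquad t\ge 0,$$ and put $\rho=\lambda\,\mathrm{vol}(B)$. For $n\ge 1$, $t_1,\dots,t_n\ge 0$ and non-empty $\pi\subseteq\{1,\dots,n\}$ let $$\bar Q_\pi(t_1,\dots,t_n)=\int_{\mathbb R^d}\mathbb P\{x+Y_{t_k}\in B\ \text{for } k\in\pi,\ x+Y_{t_k}\notin B\ \text{for } k\notin\pi\}\,dx,$$ $$U_\pi(t_1,\dots,t_n)=\frac1{\mathrm{vol}(B)}\sum_{\pi'\supseteq\pi}\bar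 Q_{\pi'}(t_1,\dots,t_n),$$ and write $U(t_1,t_2)=U_{\{1,2\}}(t_1,t_2)$. Let $B(y)=\{x\in\mathbb R^d:x+y\in B\}$. Then: 1. For every $t\ge 0$, $N(t)$ is almost surely finite and integrable, and $\mathbb E\,N(t)=\rho$. 2. For all $n\ge 1$, $t_1,\dots,t_n\ge 0$ and non-empty $\pi\subseteq\{1,\dots,n\}$, $$U_\pi(t_1,\dots,t_n)=\frac{1}{\mathrm{vol}(B)}\,\mathbb E\,\mathrm{vol}\Big(\bigcap_{j\in\pi}B(Y_{t_j})\Big).$$ 3. For all $n\ge 1$ and $t_1,\dots,t_n\ge 0$, the product $\prod_{j=1}^nN(t_j)$ is integrable and $$\mathbb E\Big[\prod_{j=1}^nN(t_j)\Big]=\sum_{k=1}^n\rho^k\sum_{\{\pi_1,\dots,\pi_k\}}\ \prod_{j=1}^kU_{\pi_j}(t_1,\dots,t_n),$$ where the inner sum is over all partitions of $\{1,\dots,n\}$ into $k$ non-empty blocks $\pi_1,\dots,\pi_k$. 4. In particular, for all $t_1,t_2\ge 0$, $$\mathbb E[N(t_1)N(t_2)]=\rho^2+\rho\,U(t_1,t_2),\qquad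 \mathrm{cov}\{N(t_1),N(t_2)\}=\rho\,U(t_1,t_2).$$ -/

import Mathlib

open MeasureTheory ProbabilityTheory
open scoped NNReal ENNReal

namespace Smoluchowski

/-- A random measure `Ξ` on `ℝ^d` is a homogeneous Poisson process with rate `lam`: the mass of every
Borel set of finite volume has the Poisson law with mean `lam * vol A`, and the masses of finitely
many pairwise disjoint Borel sets are independent. -/
structure IsHomogeneousPoissonProcess {d : ℕ} {Ω : Type*} [MeasurableSpace Ω]
    (Ξ : Ω → Measure (EuclideanSpace ℝ (Fin d))) (lam : ℝ≥0) (P : Measure Ω) : Prop where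
  hasLaw : ∀ A : Set (EuclideanSpace ℝ (Fin d)), MeasurableSet A → volume A ≠ ∞ →
    HasLaw (fun ω => Ξ ω A)
      ((poissonMeasure (lam * (volume A).toNNReal)).map (fun k : ℕ => (k : ℝ≥0∞))) P
  indep : ∀ (m : ℕ) (A : Fin m → Set (EuclideanSpace ℝ (Fin d))), (∀ i, MeasurableSet (A i)) →
    Pairwise (fun i j => Disjoint (A i) (A j)) → iIndepFun (fun i ω => Ξ ω (A i)) P

/-- The counting measure `∑ j, ε_{ξ j}` of a sequence of random points. -/
noncomputable def pointMeasure {d : ℕ} {Ω : Type*} (ξ : ℤ → Ω → EuclideanSpace ℝ (Fin d)) (ω : Ω) :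
    Measure (EuclideanSpace ℝ (Fin d)) :=
  Measure.sum (fun j => Measure.dirac (ξ j ω))

/-- The Smoluchowski process `N(t) = ∑ j, 1_B(ξ j + Y_t^(j))`, a priori with values in `[0, ∞]`. -/
noncomputable def count {d : ℕ} {Ω : Type*} (B : Set (EuclideanSpace ℝ (Fin d)))
    (ξ : ℤ → Ω → EuclideanSpace ℝ (Fin d)) (Y : ℤ → ℝ≥0 → Ω → EuclideanSpace ℝ (Fin d))
    (t : ℝ≥0) (ω : Ω) : ℝ≥0∞ :=
  ∑' j : ℤ, B.indicator (fun _ => (1 : ℝ≥0∞)) (ξ j ω + Y j t ω)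

/-- `Q_π(x; t) = P(x + Y_{t k} ∈ B for k ∈ π, and x + Y_{t k} ∉ B for k ∉ π)`. -/
noncomputable def Q {d n : ℕ} {Ω : Type*} [MeasurableSpace Ω] (P : Measure Ω)
    (B : Set (EuclideanSpace ℝ (Fin d))) (Y : ℝ≥0 → Ω → EuclideanSpace ℝ (Fin d))
    (π : Finset (Fin n)) (t : Fin n → ℝ≥0) (x : EuclideanSpace ℝ (Fin d)) : ℝ :=
  P.real {ω | (∀ k ∈ π, x + Y (t k) ω ∈ B) ∧ ∀ k ∉ π, x + Y (t k) ω ∉ B}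

/-- `Q̄_π(t) = ∫ Q_π(x; t) dx`. -/
noncomputable def Qbar {d n : ℕ} {Ω : Type*} [MeasurableSpace Ω] (P : Measure Ω)
    (B : Set (EuclideanSpace ℝ (Fin d))) (Y : ℝ≥0 → Ω → EuclideanSpace ℝ (Fin d))
    (π : Finset (Fin n)) (t : Fin n → ℝ≥0) : ℝ :=
  ∫ x, Q P B Y π t x

/-- `U_π(t) = vol(B)⁻¹ * ∑_{π' ⊇ π} Q̄_{π'}(t)`. -/
noncomputable def U {d n : ℕ} {Ω : Type*} [MeasurableSpace Ω] (P : Measure Ω)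
    (B : Set (EuclideanSpace ℝ (Fin d))) (Y : ℝ≥0 → Ω → EuclideanSpace ℝ (Fin d))
    (π : Finset (Fin n)) (t : Fin n → ℝ≥0) : ℝ :=
  1 / volume.real B * ∑ π' : Finset (Fin n) with π ⊆ π', Qbar P B Y π' t

/-- `B(y) = {x | x + y ∈ B}`. -/
def shift {d : ℕ} (B : Set (EuclideanSpace ℝ (Fin d))) (y : EuclideanSpace ℝ (Fin d)) :
    Set (EuclideanSpace ℝ (Fin d)) :=
  {x | x + y ∈ B}

end Smoluchowski

/-! Multiplied out, `∏ N(t_j)` is a sum over tuples of particle indices. Sorting the tuples by which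
entries coincide gives, for each set partition of the times, a sum over injective assignments of
particles to blocks (`prod_tsum_eq_sum_partition`); a block `π` contributes the indicator that its
particle is in `B` at every time `t_j`, `j ∈ π`.

Distinct particles have independent displacements, and the factorial moment measures of a Poisson
process are the powers of its intensity. Hence each block contributes a factor `λ ∫ P(x + Y_{t_j} ∈
B for j ∈ π) dx = ρ U_π` (`lintegral_tsum_embedding_marked`, `lam_mul_measure_hitSet`). The
factorial moments are found first on disjoint cells, where the counts are independent Poisson
variables, then on rectangles, then for all measurable functions by uniqueness of measures.

Moments are computed in `[0, ∞]`, where sums and integrals interchange freely; integrability follows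
from finiteness. Tonelli gives the volume formula, and translation invariance gives `U_{k} = 1`. -/

namespace Smoluchowski

/-! ### Products of sums and of integrals -/

/-- Tonelli's theorem for a product of functions of one coordinate each. -/
theorem lintegral_pi_prod {ι : Type*} [Fintype ι] {E : ι → Type*} [∀ i, MeasurableSpace (E i)]
    (μ : ∀ i, Measure (E i)) [∀ i, SigmaFinite (μ i)] (f : ∀ i, E i → ℝ≥0∞)
    (hf : ∀ i, Measurable (f i)) :
    ∫⁻ x, ∏ i, f i (x i) ∂Measure.pi μ = ∏ i, ∫⁻ x, f i x ∂μ i := by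
  classical
  have key : ∀ (s : Finset ι) (x : ∀ i, E i),
      (∫⋯∫⁻_s, (fun x => ∏ i ∈ s, f i (x i)) ∂μ) x = ∏ i ∈ s, ∫⁻ y, f i y ∂μ i := by
    intro s
    induction s using Finset.induction_on with
    | empty => intro x; simp
    | insert a s ha ih =>
      intro x
      have hm : ∀ t : Finset ι, Measurable fun x : ∀ i, E i => ∏ i ∈ t, f i (x i) := fun t =>
        Finset.measurable_prod _ fun i _ => (hf i).comp (measurable_pi_apply i)
      rw [lmarginal_insert' _ (hm _) ha, Finset.prod_insert ha, ← ih x]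
      have : (fun x : ∀ i, E i => ∫⁻ y, ∏ i ∈ insert a s, f i (Function.update x a y i) ∂μ a) =
          fun x => (∫⁻ y, f a y ∂μ a) * ∏ i ∈ s, f i (x i) := by
        funext x
        rw [← lintegral_mul_const _ (hf a)]
        refine lintegral_congr fun y => ?_
        rw [Finset.prod_insert ha, Function.update_self]
        congr 1
        refine Finset.prod_congr rfl fun i hi => ?_
        rw [Function.update_of_ne (ne_of_mem_of_not_mem hi ha)]
      rw [this]
      simp only [lmarginal]
      exact lintegral_const_mul _ ((hm s).comp measurable_updateFinset)
  -- A marginal integral needs a base point. Without one, some factor is empty and both sides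
  -- vanish.
  by_cases hne : Nonempty (∀ i, E i)
  · obtain ⟨x⟩ := hne
    rw [lintegral_eq_lmarginal_univ x, key]
  · have hE : IsEmpty (∀ i, E i) := not_nonempty_iff.1 hne
    obtain ⟨i, hi⟩ := isEmpty_pi.1 hE
    rw [lintegral_of_isEmpty, eq_comm, Finset.prod_eq_zero (Finset.mem_univ i)]
    exact lintegral_of_isEmpty _ _

/-- A finite product of sums is the sum over all choices of indices. -/
theorem prod_tsum_eq_tsum_prod {ι α : Type*} [Fintype ι] [Countable α] (h : ι → α → ℝ≥0∞) :
    ∏ a, ∑' i, h a i = ∑' f : ι → α, ∏ a, h a (f a) := by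
  -- Sums are integrals against counting measure, so Tonelli applies; the product measure gives each
  -- tuple mass one.
  let _ : MeasurableSpace α := ⊤
  have := lintegral_pi_prod (fun _ : ι => Measure.count (α := α)) h (fun _ => measurable_from_top)
  simp only [lintegral_count] at this
  rw [← this, lintegral_countable']
  refine tsum_congr fun f => ?_
  rw [Measure.pi_singleton]
  simp

/-! ### Counting injective tuples -/

/-- The falling factorial `x (x - 1) ⋯ (x - m + 1)` on `[0, ∞]`. -/
noncomputable def falling (m : ℕ) (x : ℝ≥0∞) : ℝ≥0∞ := ∏ i ∈ Finset.range m, (x - i)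

theorem measurable_falling (m : ℕ) : Measurable (falling m) :=
  Finset.measurable_prod _ fun _ _ => measurable_id.sub_const _

/-- Subtraction is truncated on both sides, so both vanish when `n < m`. -/
theorem falling_natCast (m n : ℕ) : falling m (n : ℝ≥0∞) = (n.descFactorial m : ℕ) := by
  rw [falling, Nat.descFactorial_eq_prod_range]
  push_cast
  rfl

/-- Injective tuples with prescribed labels are families of injections, one for each label. -/
def labelledEmbeddingEquiv {ι α κ : Type*} (L : α → κ) (c : ι → κ) :
    {e : ι ↪ α // ∀ a, L (e a) = c a} ≃ ∀ s : κ, ({a // c a = s} ↪ {x // L x = s}) where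
  toFun e s := ⟨fun a => ⟨e.1 a.1, (e.2 a.1).trans a.2⟩, fun a b hab =>
    Subtype.ext (e.1.injective (congrArg Subtype.val hab))⟩
  invFun g := ⟨⟨fun a => (g (c a) ⟨a, rfl⟩).1, fun a b hab => by
    have hab' : (g (c a) ⟨a, rfl⟩).1 = (g (c b) ⟨b, rfl⟩).1 := hab
    have hc : c b = c a := by
      rw [← (g (c a) ⟨a, rfl⟩).2, hab', (g (c b) ⟨b, rfl⟩).2]
    have hg : ∀ (s : κ) (hs : c b = s), (g (c b) ⟨b, rfl⟩).1 = (g s ⟨b, hs⟩).1 := by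
      rintro s rfl; rfl
    rw [hg _ hc] at hab'
    exact congrArg Subtype.val ((g (c a)).injective (Subtype.ext hab'))⟩, fun a => (g (c a) ⟨a, rfl⟩).2⟩
  left_inv e := by ext a; rfl
  right_inv g := by
    funext s
    ext ⟨a, rfl⟩
    rfl

/-- The number of injective tuples with prescribed labels is a product of falling factorials. -/
theorem tsum_embedding_labels {ι α κ : Type*} [Fintype ι] [Fintype κ] [DecidableEq κ]
    (L : α → κ) (c : ι → κ) (hfin : ∀ a, (∑' x, if L x = c a then (1 : ℝ≥0∞) else 0) ≠ ∞) :
    ∑' e : ι ↪ α, ∏ a, (if L (e a) = c a then (1 : ℝ≥0∞) else 0) =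
      ∏ s, falling (Finset.univ.filter fun a => c a = s).card
        (∑' x, if L x = s then (1 : ℝ≥0∞) else 0) := by
  classical
  have hcount : ∀ s, (∑' x, if L x = s then (1 : ℝ≥0∞) else 0) = ENat.card {x // L x = s} := by
    intro s
    rw [← ENNReal.tsum_one]
    rw [show (∑' _ : {x // L x = s}, (1 : ℝ≥0∞)) = _ from
      tsum_subtype {x | L x = s} (fun _ => (1 : ℝ≥0∞))]
    simp [Set.indicator_apply]
  have hfinite : ∀ a, Finite {x // L x = c a} := by
    intro a
    have := hfin a
    rw [hcount] at this
    by_contra h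
    rw [not_finite_iff_infinite] at h
    simp at this
  have hl : ∑' e : ι ↪ α, ∏ a, (if L (e a) = c a then (1 : ℝ≥0∞) else 0) =
      ENat.card {e : ι ↪ α // ∀ a, L (e a) = c a} := by
    rw [← ENNReal.tsum_one]
    rw [show (∑' _ : {e : ι ↪ α // ∀ a, L (e a) = c a}, (1 : ℝ≥0∞)) = _ from
      tsum_subtype {e : ι ↪ α | ∀ a, L (e a) = c a} (fun _ => (1 : ℝ≥0∞))]
    refine tsum_congr fun e => ?_
    rw [Finset.prod_ite_zero]
    simp [Set.indicator_apply]
  have hfac : ∀ s, Finite ({a // c a = s} ↪ {x // L x = s}) ∧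
      falling (Finset.univ.filter fun a => c a = s).card (ENat.card {x // L x = s}) =
        Nat.card ({a // c a = s} ↪ {x // L x = s}) := by
    intro s
    -- A label that `c` never takes may be carried by infinitely many points; its factor is the
    -- empty product, and there is exactly one embedding of the empty type.
    by_cases hs : ∃ a, c a = s
    · obtain ⟨a, rfl⟩ := hs
      have := hfinite a
      have := Fintype.ofFinite {x // L x = c a}
      refine ⟨inferInstance, ?_⟩
      rw [ENat.card_eq_coe_fintype_card, ENat.toENNReal_coe, falling_natCast,
        Nat.card_eq_fintype_card, Fintype.card_embedding_eq,
        Fintype.card_subtype fun b => c b = c a]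
    · have : IsEmpty {a // c a = s} := ⟨fun a => hs ⟨a.1, a.2⟩⟩
      refine ⟨inferInstance, ?_⟩
      rw [Finset.filter_false_of_mem fun a _ h => hs ⟨a, h⟩]
      simp [falling]
  have : ∀ s, Finite ({a // c a = s} ↪ {x // L x = s}) := fun s => (hfac s).1
  rw [hl, ENat.card_congr (labelledEmbeddingEquiv L c), ENat.card_eq_coe_natCard,
    ENat.toENNReal_coe, Nat.card_pi, Nat.cast_prod]
  refine Finset.prod_congr rfl fun s _ => ?_
  rw [hcount, (hfac s).2]

/-- The factorial moments of the Poisson distribution. -/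
theorem lintegral_falling_poissonMeasure (r : ℝ≥0) (m : ℕ) :
    ∫⁻ n : ℕ, falling m (n : ℝ≥0∞) ∂poissonMeasure r = (r : ℝ≥0∞) ^ m := by
  have hterm : ∀ n : ℕ, Real.exp (-r) * (r : ℝ) ^ (n + m) / (n + m).factorial *
      ((n + m).descFactorial m : ℕ) = (Real.exp (-r) * (r : ℝ) ^ n / n.factorial) * (r : ℝ) ^ m := by
    intro n
    have h := Nat.factorial_mul_descFactorial (Nat.le_add_left m n)
    rw [Nat.add_sub_cancel] at h
    rw [← h, pow_add]
    have h1 : ((n + m).descFactorial m : ℝ) ≠ 0 := by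
      have := Nat.factorial_pos (n + m)
      rw [← h] at this
      exact_mod_cast (Nat.pos_of_mul_pos_left this).ne'
    push_cast
    field_simp
  -- The terms below `m` vanish; after a shift by `m` the rest is the Poisson series times `r ^ m`.
  rw [lintegral_countable', ← Summable.sum_add_tsum_nat_add' (k := m) ENNReal.summable,
    Finset.sum_eq_zero, zero_add]
  · have : ∀ n : ℕ, falling m ((n + m : ℕ) : ℝ≥0∞) * poissonMeasure r {n + m} =
        ENNReal.ofReal (Real.exp (-r) * (r : ℝ) ^ n / n.factorial) * (r : ℝ≥0∞) ^ m := by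
      intro n
      rw [falling_natCast, poissonMeasure_singleton, ← ENNReal.ofReal_natCast,
        ← ENNReal.ofReal_mul (by positivity), mul_comm, hterm, ENNReal.ofReal_mul (by positivity),
        ENNReal.ofReal_pow (by positivity), ENNReal.ofReal_coe_nnreal]
    simp_rw [this]
    rw [ENNReal.tsum_mul_right, ← ENNReal.ofReal_tsum_of_nonneg (fun n => by positivity)
      (hasSum_one_poissonMeasure r).summable, (hasSum_one_poissonMeasure r).tsum_eq]
    simp
  · intro n hn
    rw [falling_natCast, Nat.descFactorial_of_lt (Finset.mem_range.1 hn)]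
    simp

/-! ### Tuples and set partitions -/

/-- A tuple indexed by `ι` is a set partition of `ι` with an injective labelling of its blocks. -/
def tupleOfPartition {ι α : Type*} [Fintype ι] [DecidableEq ι]
    (q : Σ p : Finpartition (Finset.univ : Finset ι), (p.parts ↪ α)) (j : ι) : α :=
  q.2 ⟨q.1.part j, q.1.part_mem.2 (Finset.mem_univ j)⟩

/-- Since the labelling is injective, the partition is the kernel of the tuple; conversely every
tuple factors injectively through its kernel. -/
theorem tupleOfPartition_bijective {ι α : Type*} [Fintype ι] [DecidableEq ι] :
    Function.Bijective (tupleOfPartition (ι := ι) (α := α)) := by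
  classical
  have hpart : ∀ (p : Finpartition (Finset.univ : Finset ι)) (e : p.parts ↪ α) (a b : ι),
      tupleOfPartition ⟨p, e⟩ a = tupleOfPartition ⟨p, e⟩ b ↔ b ∈ p.part a := by
    intro p e a b
    simp only [tupleOfPartition, e.injective.eq_iff, Subtype.mk.injEq]
    rw [p.mem_part_iff_part_eq_part (Finset.mem_univ _) (Finset.mem_univ _), eq_comm]
  constructor
  · rintro ⟨p, e⟩ ⟨p', e'⟩ h
    have hpp : ∀ a, p.part a = p'.part a := by
      intro a
      ext b
      rw [← hpart p e, ← hpart p' e', h]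
    have hle : ∀ p p' : Finpartition (Finset.univ : Finset ι), (∀ a, p.part a = p'.part a) →
        p.parts ⊆ p'.parts := by
      intro p p' hpp s hs
      obtain ⟨a, ha⟩ := p.nonempty_of_mem_parts hs
      rw [← p.part_eq_of_mem hs ha, hpp]
      exact p'.part_mem.2 (Finset.mem_univ a)
    obtain rfl : p = p' :=
      Finpartition.ext ((hle p p' hpp).antisymm (hle p' p fun a => (hpp a).symm))
    congr 1
    ext ⟨s, hs⟩
    obtain ⟨a, ha⟩ := p.nonempty_of_mem_parts hs
    have := congrFun h a
    simp only [tupleOfPartition] at this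
    obtain rfl := p.part_eq_of_mem hs ha
    exact this
  · intro f
    let p := Finpartition.ofSetoid (Setoid.ker f)
    have hp : ∀ a b, b ∈ p.part a ↔ f a = f b := fun a b =>
      Finpartition.mem_part_ofSetoid_iff_rel
    have hne : ∀ s : p.parts, ∃ a, a ∈ s.1 := fun s => p.nonempty_of_mem_parts s.2
    choose r hr using hne
    have hval : ∀ (s : p.parts) (a : ι), a ∈ s.1 → f (r s) = f a := by
      intro s a ha
      rw [← hp, p.part_eq_of_mem s.2 (hr s)]
      exact ha
    refine ⟨⟨p, ⟨fun s => f (r s), fun s t hst => ?_⟩⟩, ?_⟩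
    · have hst' : r t ∈ p.part (r s) := (hp _ _).2 hst
      rw [p.part_eq_of_mem s.2 (hr s)] at hst'
      exact Subtype.ext (p.eq_of_mem_parts s.2 t.2 hst' (hr t))
    · funext j
      exact hval _ _ (p.mem_part_self.2 (Finset.mem_univ j))

/-- A product of sums over a common index set, organised by the set partition of coinciding
indices. -/
theorem prod_tsum_eq_sum_partition {ι α : Type*} [Fintype ι] [DecidableEq ι] [Countable α]
    (h : ι → α → ℝ≥0∞) :
    ∏ j, ∑' i, h j i = ∑ p : Finpartition (Finset.univ : Finset ι),
      ∑' e : p.parts ↪ α, ∏ s : p.parts, ∏ j ∈ s.1, h j (e s) := by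
  classical
  rw [prod_tsum_eq_tsum_prod,
    ← (Equiv.ofBijective _ (tupleOfPartition_bijective (ι := ι) (α := α))).tsum_eq,
    ENNReal.tsum_sigma', tsum_fintype]
  refine Finset.sum_congr rfl fun p _ => tsum_congr fun e => ?_
  simp only [Equiv.ofBijective_apply]
  rw [← Finset.prod_fiberwise Finset.univ
    (fun j => (⟨p.part j, p.part_mem.2 (Finset.mem_univ j)⟩ : p.parts))]
  refine Finset.prod_congr rfl fun s _ => ?_
  have hs : (Finset.univ.filter fun j =>
      (⟨p.part j, p.part_mem.2 (Finset.mem_univ j)⟩ : p.parts) = s) = s.1 := by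
    ext j
    simp only [Finset.mem_filter, Finset.mem_univ, true_and, Subtype.ext_iff]
    exact p.part_eq_iff_mem s.2
  refine Finset.prod_congr hs fun j hj => ?_
  rw [← hs, Finset.mem_filter] at hj
  simp only [tupleOfPartition, hj.2]

/-! ### Factorial moment measures of the Poisson process -/

instance countable_embedding {ι α : Type*} [Finite ι] [Countable α] : Countable (ι ↪ α) :=
  DFunLike.coe_injective.countable

theorem pointMeasure_apply {d : ℕ} {Ω : Type*} {ξ : ℤ → Ω → EuclideanSpace ℝ (Fin d)} (ω : Ω)
    {A : Set (EuclideanSpace ℝ (Fin d))} (hA : MeasurableSet A) :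
    pointMeasure ξ ω A = ∑' j, A.indicator (fun _ => (1 : ℝ≥0∞)) (ξ j ω) := by
  rw [pointMeasure, Measure.sum_apply _ hA]
  exact tsum_congr fun j => Measure.dirac_apply' _ hA

section Poisson

variable {d : ℕ} {Ω : Type*} [MeasurableSpace Ω] {P : Measure Ω} {lam : ℝ≥0}
  {ξ : ℤ → Ω → EuclideanSpace ℝ (Fin d)}

theorem measurable_pointMeasure_apply (hξ : ∀ j, Measurable (ξ j))
    {A : Set (EuclideanSpace ℝ (Fin d))} (hA : MeasurableSet A) :
    Measurable fun ω => pointMeasure ξ ω A := by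
  simp_rw [pointMeasure_apply _ hA]
  exact Measurable.tsum fun j => (measurable_const.indicator hA).comp (hξ j)

theorem IsHomogeneousPoissonProcess.lintegral_falling
    (hΞ : IsHomogeneousPoissonProcess (pointMeasure ξ) lam P)
    {A : Set (EuclideanSpace ℝ (Fin d))} (hA : MeasurableSet A) (hA' : volume A ≠ ∞) (m : ℕ) :
    ∫⁻ ω, falling m (pointMeasure ξ ω A) ∂P = (lam * volume A) ^ m := by
  rw [(hΞ.hasLaw A hA hA').lintegral_comp (measurable_falling m).aemeasurable,
    lintegral_map (measurable_falling m) (measurable_of_countable _),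
    lintegral_falling_poissonMeasure, ENNReal.coe_mul, ENNReal.coe_toNNReal hA']

theorem IsHomogeneousPoissonProcess.ae_ne_top
    (hΞ : IsHomogeneousPoissonProcess (pointMeasure ξ) lam P)
    {A : Set (EuclideanSpace ℝ (Fin d))} (hA : MeasurableSet A) (hA' : volume A ≠ ∞) :
    ∀ᵐ ω ∂P, pointMeasure ξ ω A ≠ ∞ := by
  have hs : MeasurableSet {x : ℝ≥0∞ | x ≠ ∞} := (measurableSet_singleton ∞).compl
  have hl := hΞ.hasLaw A hA hA'
  refine ae_of_ae_map (p := fun x : ℝ≥0∞ => x ≠ ∞) hl.aemeasurable ?_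
  rw [hl.map_eq, ae_map_iff (measurable_of_countable _).aemeasurable hs]
  exact ae_of_all _ fun n => ENNReal.natCast_ne_top n

theorem IsHomogeneousPoissonProcess.iIndepFun_partition
    (hΞ : IsHomogeneousPoissonProcess (pointMeasure ξ) lam P) {κ : Type*} [Fintype κ]
    (A : κ → Set (EuclideanSpace ℝ (Fin d))) (hA : ∀ s, MeasurableSet (A s))
    (hdisj : Pairwise fun s t => Disjoint (A s) (A t)) :
    iIndepFun (fun s ω => pointMeasure ξ ω (A s)) P := by
  have h := hΞ.indep (Fintype.card κ) (fun i => A ((Fintype.equivFin κ).symm i))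
    (fun i => hA _) (fun i j hij => hdisj ((Fintype.equivFin κ).symm.injective.ne hij))
  simpa [Function.comp_def] using h.precomp (Fintype.equivFin κ).injective

/-- Factorial moments of the numbers of points with prescribed labels. -/
theorem IsHomogeneousPoissonProcess.lintegral_labels
    (hΞ : IsHomogeneousPoissonProcess (pointMeasure ξ) lam P) (hξ : ∀ j, Measurable (ξ j))
    {ι κ : Type*} [Fintype ι] [Fintype κ] [DecidableEq κ]
    (φ : EuclideanSpace ℝ (Fin d) → κ) (hφ : ∀ s, MeasurableSet (φ ⁻¹' {s})) (c : ι → κ)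
    (hc : ∀ a, volume (φ ⁻¹' {c a}) ≠ ∞) :
    ∫⁻ ω, ∑' e : ι ↪ ℤ, ∏ a, (if φ (ξ (e a) ω) = c a then (1 : ℝ≥0∞) else 0) ∂P =
      ∏ a, (lam * volume (φ ⁻¹' {c a})) := by
  classical
  have hN : ∀ s ω, (∑' j, if φ (ξ j ω) = s then (1 : ℝ≥0∞) else 0) =
      pointMeasure ξ ω (φ ⁻¹' {s}) := by
    intro s ω
    rw [pointMeasure_apply _ (hφ s)]
    simp [Set.indicator_apply]
  have h1 : ∀ᵐ ω ∂P, ∑' e : ι ↪ ℤ, ∏ a, (if φ (ξ (e a) ω) = c a then (1 : ℝ≥0∞) else 0) =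
      ∏ s, falling (Finset.univ.filter fun a => c a = s).card
        (pointMeasure ξ ω (φ ⁻¹' {s})) := by
    have : ∀ᵐ ω ∂P, ∀ a, pointMeasure ξ ω (φ ⁻¹' {c a}) ≠ ∞ :=
      ae_all_iff.2 fun a => hΞ.ae_ne_top (hφ _) (hc a)
    filter_upwards [this] with ω hω
    rw [tsum_embedding_labels (fun j => φ (ξ j ω)) c fun a => by rw [hN]; exact hω a]
    simp_rw [hN]
  rw [lintegral_congr_ae h1,
    lintegral_prod_eq_prod_lintegral_of_indepFun Finset.univ
      (fun s ω => falling (Finset.univ.filter fun a => c a = s).card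
        (pointMeasure ξ ω (φ ⁻¹' {s})))
      ((hΞ.iIndepFun_partition (fun s => φ ⁻¹' {s}) hφ fun s t hst =>
        (Set.disjoint_singleton.2 hst).preimage φ).comp _ fun s => measurable_falling _)
      (fun s => (measurable_falling _).comp (measurable_pointMeasure_apply hξ (hφ s))),
    ← Finset.prod_fiberwise Finset.univ c]
  refine Finset.prod_congr rfl fun s _ => ?_
  rw [Finset.prod_congr rfl (g := fun _ => lam * volume (φ ⁻¹' {s})) fun a ha => by
    rw [(Finset.mem_filter.1 ha).2], Finset.prod_const]
  by_cases hs : ∃ a, c a = s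
  · obtain ⟨a, rfl⟩ := hs
    exact hΞ.lintegral_falling (hφ _) (hc a) _
  -- An unused cell may have infinite volume, but its factor is the constant 1, so only the total
  -- mass of `P` matters. That this is 1 is read off from the law of the count of the empty set.
  · have := hΞ.hasLaw ∅ MeasurableSet.empty (by simp)
    have := this.isProbabilityMeasure
    rw [Finset.filter_false_of_mem fun a _ h => hs ⟨a, h⟩]
    simp [falling]

/-- Factorial moment measures of a Poisson process on rectangles of finite volume. -/
theorem IsHomogeneousPoissonProcess.lintegral_rectangle
    (hΞ : IsHomogeneousPoissonProcess (pointMeasure ξ) lam P) (hξ : ∀ j, Measurable (ξ j))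
    {ι : Type*} [Fintype ι] (A : ι → Set (EuclideanSpace ℝ (Fin d)))
    (hA : ∀ a, MeasurableSet (A a)) (hA' : ∀ a, volume (A a) ≠ ∞) :
    ∫⁻ ω, ∑' e : ι ↪ ℤ, ∏ a, (A a).indicator (fun _ => (1 : ℝ≥0∞)) (ξ (e a) ω) ∂P =
      ∏ a, (lam * volume (A a)) := by
  classical
  -- The sets `A a` may overlap. `φ` records which of them contain `x`; its fibres are disjoint
  -- cells, and each `A a` is a union of cells. Both sides are then expanded over choices of one
  -- cell in each `A a`.
  let φ : EuclideanSpace ℝ (Fin d) → (ι → Bool) := fun x a => decide (x ∈ A a)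
  have hφm : Measurable φ := measurable_pi_lambda _ fun a =>
    measurable_to_bool (by simpa [Set.preimage, φ] using hA a)
  have hφ : ∀ s, MeasurableSet (φ ⁻¹' {s}) := fun s => hφm (measurableSet_singleton s)
  have hsub : ∀ (s : ι → Bool) a, s a = true → φ ⁻¹' {s} ⊆ A a := by
    rintro s a hs x rfl
    simpa [φ] using hs
  let S : ι → Finset (ι → Bool) := fun a => Finset.univ.filter fun s => s a = true
  have hind : ∀ a x, (A a).indicator (fun _ => (1 : ℝ≥0∞)) x =
      ∑ s ∈ S a, if φ x = s then 1 else 0 := by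
    intro a x
    rw [Finset.sum_ite_eq]
    simp [S, φ, Set.indicator_apply]
  have hvol : ∀ a, volume (A a) = ∑ s ∈ S a, volume (φ ⁻¹' {s}) := by
    intro a
    rw [← measure_biUnion_finset (fun s _ t _ hst => (Set.disjoint_singleton.2 hst).preimage φ)
      fun s _ => hφ s]
    congr 1
    ext x
    simp [S, φ]
  have hm : ∀ (c : ι → ι → Bool) (e : ι ↪ ℤ), Measurable fun ω =>
      ∏ a, (if φ (ξ (e a) ω) = c a then (1 : ℝ≥0∞) else 0) := fun c e =>
    Finset.measurable_prod _ fun a _ =>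
      Measurable.ite ((hφ (c a)).preimage (hξ (e a))) measurable_const measurable_const
  simp_rw [hind, hvol, Finset.mul_sum, Finset.prod_univ_sum]
  simp_rw [Summable.tsum_finsetSum (fun _ _ => ENNReal.summable)]
  rw [lintegral_finsetSum _ fun c _ => Measurable.tsum fun e => hm c e]
  refine Finset.sum_congr rfl fun c hc => ?_
  refine hΞ.lintegral_labels hξ φ hφ c fun a => ?_
  have := (Fintype.mem_piFinset.1 hc) a
  exact measure_ne_top_of_subset (hsub _ a (Finset.mem_filter.1 this).2) (hA' a)

/-- The factorial moment measures of a homogeneous Poisson process are the powers of its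
intensity measure. -/
theorem IsHomogeneousPoissonProcess.lintegral_tsum_embedding
    (hΞ : IsHomogeneousPoissonProcess (pointMeasure ξ) lam P) (hξ : ∀ j, Measurable (ξ j))
    {ι : Type*} [Fintype ι] {F : (ι → EuclideanSpace ℝ (Fin d)) → ℝ≥0∞} (hF : Measurable F) :
    ∑' e : ι ↪ ℤ, ∫⁻ ω, F (fun a => ξ (e a) ω) ∂P =
      ∫⁻ x, F x ∂Measure.pi fun _ : ι => lam • (volume : Measure (EuclideanSpace ℝ (Fin d))) := by
  classical
  have hξe : ∀ e : ι ↪ ℤ, Measurable fun ω a => ξ (e a) ω := fun e =>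
    measurable_pi_lambda _ fun a => hξ (e a)
  have hpi : (Measure.pi fun _ : ι => lam • (volume : Measure (EuclideanSpace ℝ (Fin d)))) =
      Measure.sum fun e : ι ↪ ℤ => P.map fun ω a => ξ (e a) ω := by
    let V : (lam • (volume : Measure (EuclideanSpace ℝ (Fin d)))).FiniteSpanningSetsIn
        {A | MeasurableSet A ∧ volume A ≠ ∞} :=
      { set := fun n => spanningSets volume n
        set_mem := fun n => ⟨measurableSet_spanningSets _ n, (measure_spanningSets_lt_top _ n).ne⟩
        finite := fun n => by
          rw [Measure.smul_apply]
          exact ENNReal.mul_lt_top ENNReal.coe_lt_top (measure_spanningSets_lt_top _ n)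
        spanning := iUnion_spanningSets _ }
    -- The sets of finite volume form a generating π-system that contains a spanning sequence, so
    -- agreement on rectangles suffices.
    refine Measure.pi_eq_generateFrom
      (C := fun _ => {A | MeasurableSet A ∧ volume A ≠ ∞}) (fun _ => ?_) (fun _ => ?_)
      (fun _ => V) ?_
    · refine le_antisymm (MeasurableSpace.generateFrom_le fun A hA => hA.1) fun A hA => ?_
      rw [← Set.inter_univ A, ← iUnion_spanningSets
        (volume : Measure (EuclideanSpace ℝ (Fin d))), Set.inter_iUnion]
      refine MeasurableSet.iUnion fun n => MeasurableSpace.measurableSet_generateFrom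
        ⟨hA.inter (measurableSet_spanningSets _ n), measure_ne_top_of_subset
          Set.inter_subset_right (measure_spanningSets_lt_top _ n).ne⟩
    · rintro A hA A' hA' -
      exact ⟨hA.1.inter hA'.1, measure_ne_top_of_subset Set.inter_subset_left hA.2⟩
    · intro A hA
      have hAm : MeasurableSet (Set.univ.pi A) := MeasurableSet.univ_pi fun a => (hA a).1
      rw [Measure.sum_apply _ hAm]
      have h := hΞ.lintegral_rectangle hξ A (fun a => (hA a).1) fun a => (hA a).2
      have hm : ∀ e : ι ↪ ℤ, Measurable fun ω =>
          ∏ a, (A a).indicator (fun _ => (1 : ℝ≥0∞)) (ξ (e a) ω) := fun e =>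
        Finset.measurable_prod _ fun a _ =>
          (measurable_const.indicator (hA a).1).comp (hξ (e a))
      rw [lintegral_tsum fun e => (hm e).aemeasurable] at h
      simp only [Measure.smul_apply, ENNReal.smul_def, smul_eq_mul]
      rw [← h]
      refine tsum_congr fun e => ?_
      rw [Measure.map_apply (hξe e) hAm, ← lintegral_indicator_one (hξe e hAm)]
      refine lintegral_congr fun ω => ?_
      simp only [Set.indicator_apply, Finset.prod_ite_zero]
      simp
  rw [hpi, lintegral_sum_measure]
  exact tsum_congr fun e => (lintegral_map hF (hξe e)).symm

/-- Factorial moments of an independently marked homogeneous Poisson process. -/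
theorem IsHomogeneousPoissonProcess.lintegral_tsum_embedding_marked [IsProbabilityMeasure P]
    (hΞ : IsHomogeneousPoissonProcess (pointMeasure ξ) lam P) (hξ : ∀ j, Measurable (ξ j))
    {𝓜 : Type*} [MeasurableSpace 𝓜] {ν : Measure 𝓜} [IsProbabilityMeasure ν] {Z : ℤ → Ω → 𝓜}
    (hZ : ∀ j, Measurable (Z j)) (hZν : ∀ j, P.map (Z j) = ν) (hZindep : iIndepFun Z P)
    (hξZ : IndepFun (fun ω j => ξ j ω) (fun ω j => Z j ω) P)
    {ι : Type*} [Fintype ι] {g : ι → EuclideanSpace ℝ (Fin d) × 𝓜 → ℝ≥0∞}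
    (hg : ∀ a, Measurable (g a)) :
    ∫⁻ ω, ∑' e : ι ↪ ℤ, ∏ a, g a (ξ (e a) ω, Z (e a) ω) ∂P =
      ∏ a, (lam * ∫⁻ x, ∫⁻ z, g a (x, z) ∂ν) := by
  have hf : ∀ a, Measurable fun x => ∫⁻ z, g a (x, z) ∂ν := fun a => (hg a).lintegral_prod_right'
  have hm : ∀ e : ι ↪ ℤ, Measurable fun ω => ∏ a, g a (ξ (e a) ω, Z (e a) ω) := fun e =>
    Finset.measurable_prod _ fun a _ => (hg a).comp ((hξ _).prodMk (hZ _))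
  rw [lintegral_tsum fun e => (hm e).aemeasurable]
  -- For a fixed injective `e` the marks involved are i.i.d. and independent of the points, so they
  -- can be integrated out coordinate by coordinate.
  have hstep : ∀ e : ι ↪ ℤ, ∫⁻ ω, ∏ a, g a (ξ (e a) ω, Z (e a) ω) ∂P =
      ∫⁻ ω, ∏ a, ∫⁻ z, g a (ξ (e a) ω, z) ∂ν ∂P := by
    intro e
    have hX : Measurable fun ω a => ξ (e a) ω := measurable_pi_lambda _ fun a => hξ (e a)
    have hW : Measurable fun ω a => Z (e a) ω := measurable_pi_lambda _ fun a => hZ (e a)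
    have hind : IndepFun (fun ω a => ξ (e a) ω) (fun ω a => Z (e a) ω) P :=
      hξZ.comp (φ := fun x a => x (e a)) (ψ := fun z a => z (e a))
        (measurable_pi_lambda _ fun a => measurable_pi_apply _)
        (measurable_pi_lambda _ fun a => measurable_pi_apply _)
    have hlaw := (indepFun_iff_map_prod_eq_prod_map_map hX.aemeasurable hW.aemeasurable).1 hind
    have hlawZ : P.map (fun ω a => Z (e a) ω) = Measure.pi fun _ : ι => ν := by
      rw [(iIndepFun_iff_map_fun_eq_pi_map fun a => (hZ (e a)).aemeasurable).1
        (hZindep.precomp e.injective)]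
      simp only [hZν]
    have hG : Measurable fun q : (ι → EuclideanSpace ℝ (Fin d)) × (ι → 𝓜) =>
        ∏ a, g a (q.1 a, q.2 a) :=
      Finset.measurable_prod _ fun a _ => (hg a).comp
        (((measurable_pi_apply a).comp measurable_fst).prodMk
          ((measurable_pi_apply a).comp measurable_snd))
    calc ∫⁻ ω, ∏ a, g a (ξ (e a) ω, Z (e a) ω) ∂P
        = ∫⁻ q, ∏ a, g a (q.1 a, q.2 a)
            ∂P.map fun ω => ((fun a => ξ (e a) ω), fun a => Z (e a) ω) :=
          (lintegral_map hG (hX.prodMk hW)).symm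
      _ = ∫⁻ x, ∏ a, ∫⁻ z, g a (x a, z) ∂ν ∂P.map fun ω a => ξ (e a) ω := by
          rw [hlaw, hlawZ, lintegral_prod _ hG.aemeasurable]
          exact lintegral_congr fun x =>
            lintegral_pi_prod _ _ fun a => (hg a).comp measurable_prodMk_left
      _ = ∫⁻ ω, ∏ a, ∫⁻ z, g a (ξ (e a) ω, z) ∂ν ∂P :=
          lintegral_map (Finset.measurable_prod _ fun a _ =>
            (hf a).comp (measurable_pi_apply a)) hX
  simp_rw [hstep]
  rw [hΞ.lintegral_tsum_embedding hξ (F := fun x => ∏ a, ∫⁻ z, g a (x a, z) ∂ν)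
    (Finset.measurable_prod _ fun a _ => (hf a).comp (measurable_pi_apply a)),
    lintegral_pi_prod _ _ hf]
  simp_rw [lintegral_smul_measure, ENNReal.smul_def, smul_eq_mul]

end Poisson

/-! ### The functionals `U` as normalised expected volumes -/

theorem volume_shift {d : ℕ} (B : Set (EuclideanSpace ℝ (Fin d))) (y : EuclideanSpace ℝ (Fin d)) :
    volume (shift B y) = volume B :=
  measure_preimage_add_right volume y B

section ExpectedVolume

variable {d n : ℕ} {Ω' : Type*} {B : Set (EuclideanSpace ℝ (Fin d))}
  {Y₀ : ℝ≥0 → Ω' → EuclideanSpace ℝ (Fin d)} {t : Fin n → ℝ≥0}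

/-- The pairs of a starting point `x` and an outcome for which `x + Y_{t k} ∈ B` for all `k ∈ π`. -/
def hitSet (B : Set (EuclideanSpace ℝ (Fin d))) (Y₀ : ℝ≥0 → Ω' → EuclideanSpace ℝ (Fin d))
    (π : Finset (Fin n)) (t : Fin n → ℝ≥0) : Set (EuclideanSpace ℝ (Fin d) × Ω') :=
  {q | ∀ k ∈ π, q.1 + Y₀ (t k) q.2 ∈ B}

/-- The pairs of a starting point `x` and an outcome for which `π` is exactly the set of `k` with
`x + Y_{t k} ∈ B`. -/
def exactHitSet (B : Set (EuclideanSpace ℝ (Fin d))) (Y₀ : ℝ≥0 → Ω' → EuclideanSpace ℝ (Fin d))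
    (π : Finset (Fin n)) (t : Fin n → ℝ≥0) : Set (EuclideanSpace ℝ (Fin d) × Ω') :=
  {q | (∀ k ∈ π, q.1 + Y₀ (t k) q.2 ∈ B) ∧ ∀ k ∉ π, q.1 + Y₀ (t k) q.2 ∉ B}

theorem hitSet_eq_biUnion (π : Finset (Fin n)) :
    hitSet B Y₀ π t = ⋃ π' ∈ Finset.univ.filter (π ⊆ ·), exactHitSet B Y₀ π' t := by
  classical
  ext q
  simp only [hitSet, exactHitSet, Set.mem_iUnion, Finset.mem_filter, Finset.mem_univ, true_and,
    Set.mem_ofPred_eq, exists_prop]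
  constructor
  · intro h
    exact ⟨Finset.univ.filter fun k => q.1 + Y₀ (t k) q.2 ∈ B, fun k hk => by simpa using h k hk,
      by simp, by simp⟩
  · rintro ⟨π', hsub, h, -⟩ k hk
    exact h k (hsub hk)

theorem exactHitSet_disjoint {π π' : Finset (Fin n)} (hne : π ≠ π') :
    Disjoint (exactHitSet B Y₀ π t) (exactHitSet B Y₀ π' t) := by
  rw [Set.disjoint_left]
  rintro q ⟨h1, h2⟩ ⟨h3, h4⟩
  refine hne (Finset.ext fun k => ⟨fun hk => ?_, fun hk => ?_⟩)
  · by_contra hk'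
    exact h4 k hk' (h1 k hk)
  · by_contra hk'
    exact h2 k hk' (h3 k hk)

variable [MeasurableSpace Ω'] {P' : Measure Ω'}

theorem measurableSet_hit (hB : MeasurableSet B) (hY₀ : ∀ t, Measurable (Y₀ t)) (s : ℝ≥0) :
    MeasurableSet {q : EuclideanSpace ℝ (Fin d) × Ω' | q.1 + Y₀ s q.2 ∈ B} :=
  (measurable_fst.add ((hY₀ s).comp measurable_snd)) hB

theorem measurableSet_hitSet (hB : MeasurableSet B) (hY₀ : ∀ t, Measurable (Y₀ t))
    (π : Finset (Fin n)) : MeasurableSet (hitSet B Y₀ π t) := by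
  simp only [hitSet, Set.ofPred_forall]
  exact MeasurableSet.iInter fun k => MeasurableSet.iInter fun _ => measurableSet_hit hB hY₀ _

theorem measurableSet_exactHitSet (hB : MeasurableSet B) (hY₀ : ∀ t, Measurable (Y₀ t))
    (π : Finset (Fin n)) : MeasurableSet (exactHitSet B Y₀ π t) := by
  simp only [exactHitSet, Set.ofPred_and, Set.ofPred_forall]
  exact (MeasurableSet.iInter fun k => MeasurableSet.iInter fun _ =>
    measurableSet_hit hB hY₀ _).inter (MeasurableSet.iInter fun k => MeasurableSet.iInter fun _ =>
      (measurableSet_hit hB hY₀ _).compl)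

theorem U_nonneg (π : Finset (Fin n)) : 0 ≤ U P' B Y₀ π t :=
  mul_nonneg (by positivity) (Finset.sum_nonneg fun _ _ =>
    integral_nonneg fun _ => measureReal_nonneg)

variable [IsProbabilityMeasure P']

theorem measure_hitSet (hB : MeasurableSet B) (hY₀ : ∀ t, Measurable (Y₀ t))
    (π : Finset (Fin n)) :
    (volume.prod P') (hitSet B Y₀ π t) =
      ∫⁻ ω, volume (⋂ j ∈ π, shift B (Y₀ (t j) ω)) ∂P' := by
  rw [Measure.prod_apply_symm (measurableSet_hitSet hB hY₀ π)]
  refine lintegral_congr fun ω => congrArg _ ?_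
  ext x
  simp [hitSet, shift]

theorem measure_hitSet_singleton (hB : MeasurableSet B) (hY₀ : ∀ t, Measurable (Y₀ t))
    (k : Fin n) : (volume.prod P') (hitSet B Y₀ {k} t) = volume B := by
  rw [measure_hitSet hB hY₀]
  simp [volume_shift]

theorem measure_hitSet_ne_top (hB : MeasurableSet B) (hB' : volume B ≠ ∞)
    (hY₀ : ∀ t, Measurable (Y₀ t)) {π : Finset (Fin n)} (hπ : π.Nonempty) :
    (volume.prod P') (hitSet B Y₀ π t) ≠ ∞ := by
  obtain ⟨k, hk⟩ := hπ
  refine measure_ne_top_of_subset (s := hitSet B Y₀ {k} t) (t := hitSet B Y₀ π t) ?_ ?_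
  · intro q hq j hj
    rw [Finset.mem_singleton.1 hj]
    exact hq k hk
  · rwa [measure_hitSet_singleton hB hY₀]

/-- Tonelli. Finiteness matters: for `π = ∅` the measure can be infinite, and real-valued integrals
then take a default value. -/
theorem Qbar_eq (hB : MeasurableSet B) (hY₀ : ∀ t, Measurable (Y₀ t)) (π : Finset (Fin n))
    (hfin : (volume.prod P') (exactHitSet B Y₀ π t) ≠ ∞) :
    Qbar P' B Y₀ π t = ((volume.prod P') (exactHitSet B Y₀ π t)).toReal := by
  have hm := measurableSet_exactHitSet (t := t) hB hY₀ π
  rw [Measure.prod_apply hm] at hfin ⊢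
  rw [← integral_toReal (measurable_measure_prodMk_left hm).aemeasurable
    (ae_lt_top (measurable_measure_prodMk_left hm) hfin)]
  rfl

theorem U_eq_measure_hitSet (hB : MeasurableSet B) (hB' : volume B ≠ ∞)
    (hY₀ : ∀ t, Measurable (Y₀ t)) {π : Finset (Fin n)} (hπ : π.Nonempty) :
    U P' B Y₀ π t = ((volume.prod P') (hitSet B Y₀ π t)).toReal / volume.real B := by
  have hfin := measure_hitSet_ne_top (P' := P') (t := t) hB hB' hY₀ hπ
  have hsub : ∀ π' ∈ Finset.univ.filter (π ⊆ ·),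
      (volume.prod P') (exactHitSet B Y₀ π' t) ≠ ∞ := by
    intro π' hπ'
    refine measure_ne_top_of_subset ?_ hfin
    rw [hitSet_eq_biUnion]
    exact Set.subset_biUnion_of_mem (u := fun π' => exactHitSet B Y₀ π' t)
      (Finset.mem_coe.2 hπ')
  rw [U, one_div_mul_eq_div, hitSet_eq_biUnion, measure_biUnion_finset
    (fun _ _ _ _ hne => exactHitSet_disjoint hne) fun π' _ => measurableSet_exactHitSet hB hY₀ π',
    ENNReal.toReal_sum hsub]
  congr 1
  exact Finset.sum_congr rfl fun π' hπ' => Qbar_eq hB hY₀ π' (hsub π' hπ')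

theorem U_eq_expected_volume (hB : MeasurableSet B) (hB' : volume B ≠ ∞)
    (hY₀ : ∀ t, Measurable (Y₀ t)) {π : Finset (Fin n)} (hπ : π.Nonempty) :
    U P' B Y₀ π t =
      (∫ ω, volume.real (⋂ j ∈ π, shift B (Y₀ (t j) ω)) ∂P') / volume.real B := by
  have hfin := measure_hitSet_ne_top (P' := P') (t := t) hB hB' hY₀ hπ
  have hm : Measurable fun ω => volume (⋂ j ∈ π, shift B (Y₀ (t j) ω)) := by
    convert measurable_measure_prodMk_right (μ := volume)
      (measurableSet_hitSet (t := t) hB hY₀ π) using 3 with ω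
    ext x
    simp [hitSet, shift]
  rw [U_eq_measure_hitSet hB hB' hY₀ hπ]
  rw [measure_hitSet hB hY₀] at hfin ⊢
  rw [← integral_toReal hm.aemeasurable (ae_lt_top hm hfin)]
  rfl

theorem U_singleton (hB : MeasurableSet B) (hB' : volume B ≠ ∞) (hB0 : volume B ≠ 0)
    (hY₀ : ∀ t, Measurable (Y₀ t)) (k : Fin n) : U P' B Y₀ {k} t = 1 := by
  rw [U_eq_measure_hitSet hB hB' hY₀ (Finset.singleton_nonempty k),
    measure_hitSet_singleton hB hY₀]
  exact div_self (ENNReal.toReal_pos hB0 hB').ne'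

theorem lam_mul_measure_hitSet {lam : ℝ≥0} (hB : MeasurableSet B) (hB' : volume B ≠ ∞)
    (hB0 : volume B ≠ 0) (hY₀ : ∀ t, Measurable (Y₀ t)) {π : Finset (Fin n)} (hπ : π.Nonempty) :
    lam * (volume.prod P') (hitSet B Y₀ π t) =
      ENNReal.ofReal (lam * volume.real B * U P' B Y₀ π t) := by
  have hpos : volume.real B ≠ 0 := (ENNReal.toReal_pos hB0 hB').ne'
  rw [U_eq_measure_hitSet hB hB' hY₀ hπ, mul_assoc, mul_div_cancel₀ _ hpos,
    ENNReal.ofReal_mul (by positivity), ENNReal.ofReal_coe_nnreal,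
    ENNReal.ofReal_toReal (measure_hitSet_ne_top hB hB' hY₀ hπ)]

end ExpectedVolume

/-! ### Mixed moments of the Smoluchowski process -/

theorem measurable_count {d : ℕ} {Ω : Type*} [MeasurableSpace Ω]
    {B : Set (EuclideanSpace ℝ (Fin d))} (hB : MeasurableSet B)
    {ξ : ℤ → Ω → EuclideanSpace ℝ (Fin d)} (hξ : ∀ j, Measurable (ξ j))
    {Y : ℤ → ℝ≥0 → Ω → EuclideanSpace ℝ (Fin d)} (hY : ∀ j t, Measurable (Y j t)) (t : ℝ≥0) :
    Measurable (count B ξ Y t) :=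
  Measurable.tsum fun j => (measurable_const.indicator hB).comp ((hξ j).add (hY j t))

/-- The mixed moments of the Smoluchowski process, as a sum over set partitions. -/
theorem lintegral_prod_count {d n : ℕ} {Ω Ω' : Type*} [MeasurableSpace Ω] [MeasurableSpace Ω']
    {P : Measure Ω} [IsProbabilityMeasure P] {P' : Measure Ω'} [IsProbabilityMeasure P']
    {lam : ℝ≥0} {B : Set (EuclideanSpace ℝ (Fin d))} (hB : MeasurableSet B)
    {ξ : ℤ → Ω → EuclideanSpace ℝ (Fin d)} (hξ : ∀ j, Measurable (ξ j))
    (hΞ : IsHomogeneousPoissonProcess (pointMeasure ξ) lam P)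
    {Y₀ : ℝ≥0 → Ω' → EuclideanSpace ℝ (Fin d)} (hY₀ : ∀ t, Measurable (Y₀ t))
    {Y : ℤ → ℝ≥0 → Ω → EuclideanSpace ℝ (Fin d)} (hY : ∀ j t, Measurable (Y j t))
    (hcopy : ∀ j, IdentDistrib (fun ω t => Y j t ω) (fun ω t => Y₀ t ω) P P')
    (hYindep : iIndepFun (fun j ω t => Y j t ω) P)
    (hξY : IndepFun (fun ω j => ξ j ω) (fun ω j t => Y j t ω) P) (t : Fin n → ℝ≥0) :
    ∫⁻ ω, ∏ j, count B ξ Y (t j) ω ∂P =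
      ∑ p : Finpartition (Finset.univ : Finset (Fin n)),
        ∏ π ∈ p.parts, (lam * (volume.prod P') (hitSet B Y₀ π t)) := by
  classical
  have hY₀' : Measurable fun ω t => Y₀ t ω := measurable_pi_lambda _ hY₀
  have hY' : ∀ j, Measurable fun ω t => Y j t ω := fun j => measurable_pi_lambda _ (hY j)
  have := Measure.isProbabilityMeasure_map (μ := P') hY₀'.aemeasurable
  let g : Finset (Fin n) → EuclideanSpace ℝ (Fin d) × (ℝ≥0 → EuclideanSpace ℝ (Fin d)) → ℝ≥0∞ :=
    fun π q => ∏ j ∈ π, B.indicator (fun _ => 1) (q.1 + q.2 (t j))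
  have hg : ∀ π, Measurable (g π) := fun π => Finset.measurable_prod _ fun j _ =>
    (measurable_const.indicator hB).comp
      (measurable_fst.add ((measurable_pi_apply (t j)).comp measurable_snd))
  have hgint : ∀ π, ∫⁻ x, ∫⁻ z, g π (x, z) ∂P'.map (fun ω t => Y₀ t ω) =
      (volume.prod P') (hitSet B Y₀ π t) := by
    intro π
    have hm := measurableSet_hitSet (t := t) hB hY₀ π
    rw [Measure.prod_apply hm]
    refine lintegral_congr fun x => ?_
    rw [lintegral_map (f := fun z => g π (x, z)) ((hg π).comp measurable_prodMk_left) hY₀',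
      ← lintegral_indicator_one (measurable_prodMk_left hm)]
    refine lintegral_congr fun ω => ?_
    simp only [g, Set.indicator_apply, Finset.prod_ite_zero, Finset.prod_const_one, hitSet,
      Set.mem_preimage, Set.mem_ofPred_eq, Pi.one_apply]
  have hmeas : ∀ p : Finpartition (Finset.univ : Finset (Fin n)), Measurable fun ω =>
      ∑' e : p.parts ↪ ℤ, ∏ π : p.parts, g π.1 (ξ (e π) ω, fun s => Y (e π) s ω) := fun p =>
    Measurable.tsum fun e => Finset.measurable_prod _ fun π _ =>
      (hg π.1).comp ((hξ _).prodMk (hY' _))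
  calc ∫⁻ ω, ∏ j, count B ξ Y (t j) ω ∂P
      = ∫⁻ ω, ∑ p : Finpartition (Finset.univ : Finset (Fin n)), ∑' e : p.parts ↪ ℤ,
          ∏ π : p.parts, g π.1 (ξ (e π) ω, fun s => Y (e π) s ω) ∂P :=
        lintegral_congr fun ω => prod_tsum_eq_sum_partition
          (fun j i => B.indicator (fun _ => (1 : ℝ≥0∞)) (ξ i ω + Y i (t j) ω))
    _ = ∑ p : Finpartition (Finset.univ : Finset (Fin n)),
          ∏ π : p.parts, (lam * (volume.prod P') (hitSet B Y₀ π.1 t)) := by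
        rw [lintegral_finsetSum _ fun p _ => hmeas p]
        refine Finset.sum_congr rfl fun p _ => ?_
        rw [hΞ.lintegral_tsum_embedding_marked hξ hY' (fun j => (hcopy j).map_eq) hYindep hξY
          fun π : p.parts => hg π.1]
        simp_rw [hgint]
    _ = _ := Finset.sum_congr rfl fun p _ =>
        Finset.prod_coe_sort p.parts fun π => lam * (volume.prod P') (hitSet B Y₀ π t)

theorem sum_finpartition_fin_one (f : Finset (Fin 1) → ℝ) :
    ∑ p : Finpartition (Finset.univ : Finset (Fin 1)), ∏ π ∈ p.parts, f π = f {0} := by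
  -- A partition is determined by its set of blocks, so the sum can be moved to explicit finsets
  -- that `decide` enumerates.
  have h : (Finset.univ : Finset (Finpartition (Finset.univ : Finset (Fin 1)))).image
      Finpartition.parts = {{{0}}} := by decide
  rw [← Finset.sum_image (f := fun s => ∏ π ∈ s, f π) (g := Finpartition.parts)
    fun p _ q _ hpq => Finpartition.ext hpq, h]
  simp

theorem sum_finpartition_fin_two (f : Finset (Fin 2) → ℝ) :
    ∑ p : Finpartition (Finset.univ : Finset (Fin 2)), ∏ π ∈ p.parts, f π =
      f {0} * f {1} + f {0, 1} := by
  have h : (Finset.univ : Finset (Finpartition (Finset.univ : Finset (Fin 2)))).image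
      Finpartition.parts = {{{0}, {1}}, {{0, 1}}} := by decide
  rw [← Finset.sum_image (f := fun s => ∏ π ∈ s, f π) (g := Finpartition.parts)
    fun p _ q _ hpq => Finpartition.ext hpq, h, Finset.sum_pair (by decide),
    Finset.prod_pair (by decide), Finset.prod_singleton]

theorem sum_finpartition_by_card {n : ℕ} (hn : 1 ≤ n) (ρ : ℝ) (f : Finset (Fin n) → ℝ) :
    ∑ p : Finpartition (Finset.univ : Finset (Fin n)), ∏ π ∈ p.parts, (ρ * f π) =
      ∑ k ∈ Finset.Icc 1 n, ρ ^ k *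
        ∑ p : Finpartition (Finset.univ : Finset (Fin n)) with p.parts.card = k,
          ∏ π ∈ p.parts, f π := by
  have hne : (Finset.univ : Finset (Fin n)) ≠ ∅ :=
    (Finset.univ_nonempty_iff.2 ⟨⟨0, hn⟩⟩).ne_empty
  rw [← Finset.sum_fiberwise_of_maps_to (t := Finset.Icc 1 n)
    (g := fun p : Finpartition (Finset.univ : Finset (Fin n)) => p.parts.card)]
  · refine Finset.sum_congr rfl fun k _ => ?_
    rw [Finset.mul_sum]
    refine Finset.sum_congr rfl fun p hp => ?_
    rw [Finset.prod_mul_distrib, Finset.prod_const, (Finset.mem_filter.1 hp).2]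
  · intro p _
    rw [Finset.mem_Icc]
    -- For `n = 0` the only partition has no blocks, which the range from 1 would miss.
    exact ⟨Finset.card_pos.2 (p.parts_nonempty hne), by simpa using p.card_parts_le_card⟩

end Smoluchowski

/-! ### From moments in `[0, ∞]` to real moments and covariances -/

theorem mainTheorem6 {d : ℕ} {Ω Ω' : Type*} [MeasurableSpace Ω] [MeasurableSpace Ω']
    (P : Measure Ω) [IsProbabilityMeasure P] (P' : Measure Ω') [IsProbabilityMeasure P']
    (lam : ℝ≥0) (hlam : 0 < lam)
    (B : Set (EuclideanSpace ℝ (Fin d))) (hB : IsCompact B) (hBint : (interior B).Nonempty)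
    -- initial positions of the particles
    (ξ : ℤ → Ω → EuclideanSpace ℝ (Fin d)) (hξ : ∀ j, Measurable (ξ j))
    (hΞ : Smoluchowski.IsHomogeneousPoissonProcess (Smoluchowski.pointMeasure ξ) lam P)
    -- the generic displacement process and its independent copies
    (Y₀ : ℝ≥0 → Ω' → EuclideanSpace ℝ (Fin d)) (hY₀ : ∀ t, Measurable (Y₀ t))
    (Y : ℤ → ℝ≥0 → Ω → EuclideanSpace ℝ (Fin d)) (hY : ∀ j t, Measurable (Y j t))
    (hcopy : ∀ j, IdentDistrib (fun ω t => Y j t ω) (fun ω t => Y₀ t ω) P P')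
    (hYindep : iIndepFun (fun j ω t => Y j t ω) P)
    (hξY : IndepFun (fun ω j => ξ j ω) (fun ω j t => Y j t ω) P)
    (ρ : ℝ) (hρ : ρ = lam * volume.real B) :
    -- `N(t)` is almost surely finite, with mean `ρ`
    (∀ s, ∀ᵐ ω ∂P, Smoluchowski.count B ξ Y s ω < ∞) ∧
    (∀ s, Integrable (fun ω => (Smoluchowski.count B ξ Y s ω).toReal) P ∧
      ∫ ω, (Smoluchowski.count B ξ Y s ω).toReal ∂P = ρ) ∧
    -- `U_π` as a normalized expected volume
    (∀ (n : ℕ) (t : Fin n → ℝ≥0) (π : Finset (Fin n)), π.Nonempty →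
      Smoluchowski.U P' B Y₀ π t =
        (∫ ω, volume.real (⋂ j ∈ π, Smoluchowski.shift B (Y₀ (t j) ω)) ∂P') / volume.real B) ∧
    -- mixed moments
    (∀ (n : ℕ), 1 ≤ n → ∀ t : Fin n → ℝ≥0,
      Integrable (fun ω => ∏ j, (Smoluchowski.count B ξ Y (t j) ω).toReal) P ∧
      ∫ ω, ∏ j, (Smoluchowski.count B ξ Y (t j) ω).toReal ∂P =
        ∑ k ∈ Finset.Icc 1 n, ρ ^ k *
          ∑ p : Finpartition (Finset.univ : Finset (Fin n)) with p.parts.card = k,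
            ∏ π ∈ p.parts, Smoluchowski.U P' B Y₀ π t) ∧
    -- the case `n = 2`
    (∀ t₁ t₂ : ℝ≥0,
      ∫ ω, (Smoluchowski.count B ξ Y t₁ ω).toReal * (Smoluchowski.count B ξ Y t₂ ω).toReal ∂P =
        ρ ^ 2 + ρ * Smoluchowski.U P' B Y₀ {0, 1} ![t₁, t₂] ∧
      cov[fun ω => (Smoluchowski.count B ξ Y t₁ ω).toReal,
          fun ω => (Smoluchowski.count B ξ Y t₂ ω).toReal; P] =
        ρ * Smoluchowski.U P' B Y₀ {0, 1} ![t₁, t₂]) := by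
  have hBm : MeasurableSet B := hB.measurableSet
  have hBfin : volume B ≠ ∞ := hB.measure_lt_top.ne
  have hB0 : volume B ≠ 0 := (Measure.measure_pos_of_nonempty_interior volume hBint).ne'
  have hρ0 : 0 ≤ ρ := by rw [hρ]; positivity
  have hcount := Smoluchowski.measurable_count hBm hξ hY
  have hmoment : ∀ (n : ℕ) (t : Fin n → ℝ≥0),
      ∫⁻ ω, ∏ j, Smoluchowski.count B ξ Y (t j) ω ∂P =
        ENNReal.ofReal (∑ p : Finpartition (Finset.univ : Finset (Fin n)),
          ∏ π ∈ p.parts, (ρ * Smoluchowski.U P' B Y₀ π t)) := by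
    intro n t
    have hnn : ∀ π, 0 ≤ ρ * Smoluchowski.U P' B Y₀ π t := fun π =>
      mul_nonneg hρ0 (Smoluchowski.U_nonneg π)
    rw [Smoluchowski.lintegral_prod_count hBm hξ hΞ hY₀ hY hcopy hYindep hξY t,
      ENNReal.ofReal_sum_of_nonneg fun p _ => Finset.prod_nonneg fun π _ => hnn π]
    refine Finset.sum_congr rfl fun p _ => ?_
    rw [ENNReal.ofReal_prod_of_nonneg fun π _ => hnn π]
    refine Finset.prod_congr rfl fun π hπ => ?_
    rw [hρ]
    exact Smoluchowski.lam_mul_measure_hitSet hBm hBfin hB0 hY₀ (p.nonempty_of_mem_parts hπ)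
  have hreal : ∀ (n : ℕ) (t : Fin n → ℝ≥0),
      Integrable (fun ω => ∏ j, (Smoluchowski.count B ξ Y (t j) ω).toReal) P ∧
      ∫ ω, ∏ j, (Smoluchowski.count B ξ Y (t j) ω).toReal ∂P =
        ∑ p : Finpartition (Finset.univ : Finset (Fin n)),
          ∏ π ∈ p.parts, (ρ * Smoluchowski.U P' B Y₀ π t) := by
    intro n t
    have hm : Measurable fun ω => ∏ j, Smoluchowski.count B ξ Y (t j) ω :=
      Finset.measurable_prod _ fun j _ => hcount (t j)
    have hfin : ∫⁻ ω, ∏ j, Smoluchowski.count B ξ Y (t j) ω ∂P ≠ ∞ := by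
      rw [hmoment]; exact ENNReal.ofReal_ne_top
    simp_rw [← ENNReal.toReal_prod]
    refine ⟨integrable_toReal_of_lintegral_ne_top hm.aemeasurable hfin, ?_⟩
    rw [integral_toReal hm.aemeasurable (ae_lt_top hm hfin), hmoment, ENNReal.toReal_ofReal]
    exact Finset.sum_nonneg fun p _ => Finset.prod_nonneg fun π _ =>
      mul_nonneg hρ0 (Smoluchowski.U_nonneg π)
  have hmean : ∀ s, Integrable (fun ω => (Smoluchowski.count B ξ Y s ω).toReal) P ∧
      ∫ ω, (Smoluchowski.count B ξ Y s ω).toReal ∂P = ρ := by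
    intro s
    have h := hreal 1 fun _ => s
    rw [Smoluchowski.sum_finpartition_fin_one,
      Smoluchowski.U_singleton hBm hBfin hB0 hY₀, mul_one] at h
    simpa using h
  have hpair : ∀ t₁ t₂ : ℝ≥0,
      Integrable (fun ω => (Smoluchowski.count B ξ Y t₁ ω).toReal *
        (Smoluchowski.count B ξ Y t₂ ω).toReal) P ∧
      ∫ ω, (Smoluchowski.count B ξ Y t₁ ω).toReal * (Smoluchowski.count B ξ Y t₂ ω).toReal ∂P =
        ρ ^ 2 + ρ * Smoluchowski.U P' B Y₀ {0, 1} ![t₁, t₂] := by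
    intro t₁ t₂
    have h := hreal 2 ![t₁, t₂]
    rw [Smoluchowski.sum_finpartition_fin_two, Smoluchowski.U_singleton hBm hBfin hB0 hY₀,
      Smoluchowski.U_singleton hBm hBfin hB0 hY₀, mul_one, ← sq] at h
    simpa using h
  -- Square integrability is the pair moment on the diagonal `t₁ = t₂ = s`.
  have hLp : ∀ s, MemLp (fun ω => (Smoluchowski.count B ξ Y s ω).toReal) 2 P := by
    intro s
    rw [memLp_two_iff_integrable_sq (hcount s).ennreal_toReal.aestronglyMeasurable]
    simpa only [sq] using (hpair s s).1
  refine ⟨fun s => ?_, hmean, fun n t π hπ =>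
    Smoluchowski.U_eq_expected_volume hBm hBfin hY₀ hπ, fun n hn t => ?_, fun t₁ t₂ =>
    ⟨(hpair t₁ t₂).2, ?_⟩⟩
  · refine ae_lt_top (hcount s) ?_
    have h := hmoment 1 fun _ => s
    simp only [Finset.univ_unique, Finset.prod_singleton] at h
    rw [h]
    exact ENNReal.ofReal_ne_top
  · rw [← Smoluchowski.sum_finpartition_by_card hn]
    exact hreal n t
  · rw [covariance_eq_sub (hLp t₁) (hLp t₂), (hmean t₁).2, (hmean t₂).2]
    simp only [Pi.mul_apply]
    rw [(hpair t₁ t₂).2]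
    ring
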